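/- Let $B_n=\{0,1\}^n$, $|X|=\sum_i x_i$ and $a_X=|X|/n$ for $X=(x_1,\dots,x_n)\in B_n$. A quantum algorithm with $T$ queries has the final state $U_TQ_XU_{T-1}Q_X\cdots U_1Q_XU_0|\psi_0\rangle$, a unit vector in the state space of finitely many qubits, where the unitaries $U_0,\dots,U_T$ and the unit vector $|\psi_0\rangle$ do not depend on $X$ and $Q_X$ is the query $|i,b,z\rangle\mapsto|i,b\oplus x_i,z\rangle$ (with $i$ held in $\lceil\log_2 n\rceil$ qubits; $Q_X$ acts as the identity when $i$ addresses no variable). A measurement of the final state, which does not depend on $X$ either, gives one of finitely many outcomes; outcome $j$ has probability $p_X(j)$, and on it the algorithm returns a real number $\hat a(j)$. For $\tfrac12<p\le 1$ the error on the input $X$ is $$e(X,T,p)=\inf\Big\{\gamma:\ \sum_{j:\,|a_X-\hat a(j)|\le\gamma}p_X(j)\ge p\Big\}.$$ The average probabilistic error for approximate counting with respect to $\mu_2$ is $$e_1^{\mathrm{avg}}(B_n,T,p)=n\sum_{X\in B_n}e(X,T,p)\,\mu_2(X),\qquad \mu_2(X)=\frac{1}{(n+1)\binom{n}{|X|}}.$$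 There are absolute constants $c_1,c_2>0$ such that for every fixed $p\in(\tfrac12,1]$ the following two statements hold. 1. Let $T=T(n)$ be a sequence of non-negative integers with $T=o(n)$. Then, for all sufficiently large $n$, every quantum algorithm with $T(n)$ queries satisfies $$e_1^{\mathrm{avg}}(B_n,T,p)\ \ge\ c_1\,\frac{n}{\max\{T,1\}},$$ that is, its error is $\Omega(n/T)$. 2. Let $\Delta=\Delta(n)>0$ satisfy $\Delta=o(n)$. Then, for all sufficiently large $n$, every quantum algorithm (with any number $T$ of queries) such that $e_1^{\mathrm{avg}}(B_n,T,p)\le\Delta$ satisfies $$T\ \ge\ c_2\,\min\{n/\Delta,\ n\},$$ that is, the number of queries needed for error at most $\Delta$ is $\Omega(\min\{n/\Delta,n\})$. -/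

import Mathlib

open Filter Asymptotics

noncomputable section

namespace QuantumCounting

/-- An input `X = (x_1, …, x_n)` of `n` Boolean variables. -/
abbrev Input (n : ℕ) : Type := Fin n → Bool

/-- The Hamming weight `|X| = ∑ x_i`. -/
def weight {n : ℕ} (X : Input n) : ℕ := (Finset.univ.filter fun i => X i = true).card

/-- The Boolean mean `a_X = |X| / n`. -/
def mean {n : ℕ} (X : Input n) : ℝ := (weight X : ℝ) / (n : ℝ)

/-- The measure on inputs under which every value of the mean is equally likely, and all inputs
of the same weight are equally likely: the point mass of `X` is `1 / ((n + 1) * (n choose |X|))`. -/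
def mu₂ {n : ℕ} (X : Input n) : ℝ := 1 / (((n : ℝ) + 1) * (n.choose (weight X) : ℝ))

/-- Computational basis states `|i, b, z⟩` of `⌈log₂ n⌉ + 1 + w` qubits: an index register `i`
of `⌈log₂ n⌉` qubits, one target qubit `b`, and `w` work qubits `z`. -/
abbrev BasisState (n w : ℕ) : Type := (Fin (Nat.clog 2 n) → Bool) × Bool × (Fin w → Bool)

/-- The state space `ℂ² ⊗ ⋯ ⊗ ℂ²` (`⌈log₂ n⌉ + 1 + w` factors), in the computational basis. -/
abbrev StateSpace (n w : ℕ) : Type := EuclideanSpace ℂ (BasisState n w)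

/-- The bit that the oracle returns on the content `i` of the index register, read in binary
(`0, …, n - 1` address the `n` variables); the remaining contents address no variable and the
oracle then leaves the target unchanged. -/
def oracleBit {n : ℕ} (X : Input n) (i : Fin (Nat.clog 2 n) → Bool) : Bool :=
  if h : Nat.ofBits i < n then X ⟨Nat.ofBits i, h⟩ else false

/-- The action `|i, b, z⟩ ↦ |i, b ⊕ x_i, z⟩` of a query on basis states. -/
def queryPerm {n : ℕ} (w : ℕ) (X : Input n) : Equiv.Perm (BasisState n w) :=
  Function.Involutive.toPerm (fun s => (s.1, xor s.2.1 (oracleBit X s.1), s.2.2))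
    (fun s => by simp)

/-- The query operator `Q_X`, a unitary operator: the linear extension of `queryPerm`. -/
def queryOp {n : ℕ} (w : ℕ) (X : Input n) : StateSpace n w ≃ₗᵢ[ℂ] StateSpace n w :=
  LinearIsometryEquiv.piLpCongrLeft 2 ℂ ℂ (queryPerm w X)

/-- A quantum algorithm with `T` queries on inputs of `n` Boolean variables, with one measurement
at the end. Nothing in it depends on the input. -/
structure QuantumAlgorithm (n T : ℕ) where
  /-- number of work qubits -/
  w : ℕ
  /-- initial state -/
  init : StateSpace n w
  init_norm : ‖init‖ = 1
  /-- the unitary transformations `U_0, …, U_T` (those with larger index are never used) -/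
  U : ℕ → StateSpace n w ≃ₗᵢ[ℂ] StateSpace n w
  /-- number of measurement outcomes -/
  M : ℕ
  /-- measurement operators of the (general) measurement of the final state -/
  meas : Fin M → StateSpace n w →L[ℂ] StateSpace n w
  meas_complete : ∑ j, (ContinuousLinearMap.adjoint (meas j)).comp (meas j) =
    ContinuousLinearMap.id ℂ (StateSpace n w)
  /-- the approximation of the mean that is returned on outcome `j` -/
  estimate : Fin M → ℝ

namespace QuantumAlgorithm

variable {n T : ℕ}

/-- The state `U_t Q_X U_{t-1} ⋯ U_1 Q_X U_0 |ψ₀⟩` after `t` queries. -/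
def stateAfter (A : QuantumAlgorithm n T) (X : Input n) : ℕ → StateSpace n A.w
  | 0 => A.U 0 A.init
  | t + 1 => A.U (t + 1) (queryOp A.w X (A.stateAfter X t))

/-- The final state, after `T` queries. -/
def finalState (A : QuantumAlgorithm n T) (X : Input n) : StateSpace n A.w :=
  A.stateAfter X T

/-- The probability `p_X(j)` of outcome `j` on input `X`. -/
def prob (A : QuantumAlgorithm n T) (X : Input n) (j : Fin A.M) : ℝ :=
  ‖A.meas j (A.finalState X)‖ ^ 2

open Classical in
/-- The probabilistic error on input `X`: the infimum of all `γ` such that, with probability at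
least `p`, the approximation is within `γ` of the mean. -/
def error (A : QuantumAlgorithm n T) (p : ℝ) (X : Input n) : ℝ :=
  sInf {γ : ℝ | p ≤ ∑ j ∈ Finset.univ.filter (fun j => |mean X - A.estimate j| ≤ γ), A.prob X j}

/-- The average probabilistic error with respect to the point masses `μ`. -/
def avgError (A : QuantumAlgorithm n T) (μ : Input n → ℝ) (p : ℝ) : ℝ :=
  ∑ X : Input n, A.error p X * μ X

/-- The average probabilistic error for approximate counting: the error for the mean, scaled
by `n`, since `|X| = n * a_X`. -/
def avgCountError (A : QuantumAlgorithm n T) (μ : Input n → ℝ) (p : ℝ) : ℝ :=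
  (n : ℝ) * A.avgError μ p

end QuantumAlgorithm

end QuantumCounting

end

/-! Inputs of weights `k` and `k + d` that differ in `d` variables are hard to tell apart. One query
raises the squared distance of the two states by at most twice the masses both put on the differing
variables (`norm_queryOp_sub_sq_le`). Those variables are `0` in one input and `1` in the other, so
if the zeros of the first and the ones of the second are at least `n / 4` in number, a random
permutation brings each mass down to `O(d / n)` (`card_mul_sum_perm_le`). Since both masses are
small, `T` queries give an average squared distance `O(T * d / n)`, linear in `T`.

Eight weights at spacing `d` have disjoint sets of correct outcomes, and nearly equal states cannot
make all eight likely (`one_le_sum_error`). Using eight weights instead of two makes the constants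
independent of `p`: only `p > 1/2` is needed. Hence the averaged errors at the eight levels sum to
order `d / n` at least. Averaging over `k` and taking `d` of order `n / max T 1` gives the bound. -/

namespace QuantumCounting

open Finset

/-! ### Queries -/

/-- The squared norm of the part of `φ` whose index register addresses the variable `i`. -/
noncomputable def addressMass {n w : ℕ} (φ : StateSpace n w) (i : Fin n) : ℝ :=
  ∑ s : BasisState n w, if Nat.ofBits s.1 = i then ‖φ s‖ ^ 2 else 0

lemma addressMass_nonneg {n w : ℕ} (φ : StateSpace n w) (i : Fin n) : 0 ≤ addressMass φ i :=
  sum_nonneg fun s _ => by split_ifs <;> positivity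

lemma sum_addressMass_le {n w : ℕ} (φ : StateSpace n w) : ∑ i, addressMass φ i ≤ ‖φ‖ ^ 2 := by
  unfold addressMass
  rw [sum_comm, EuclideanSpace.norm_sq_eq]
  refine sum_le_sum fun s _ => ?_
  by_cases h : Nat.ofBits s.1 < n
  · rw [sum_eq_single (⟨Nat.ofBits s.1, h⟩ : Fin n)]
    · simp
    · intro i _ hi
      rw [if_neg]
      intro h'
      exact hi (Fin.ext h'.symm)
    · simp
  · rw [sum_eq_zero]
    · positivity
    · intro i _
      rw [if_neg]
      intro h'
      exact h (h' ▸ i.2)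

lemma sum_oracleBit_ne_le {n w : ℕ} (X Y : Input n) (φ : StateSpace n w) :
    (∑ s : BasisState n w, if oracleBit X s.1 ≠ oracleBit Y s.1 then ‖φ s‖ ^ 2 else 0) ≤
      ∑ i with X i ≠ Y i, addressMass φ i := by
  unfold addressMass
  rw [sum_comm]
  refine sum_le_sum fun s _ => ?_
  split_ifs with hs
  · by_cases h : Nat.ofBits s.1 < n
    · simp only [oracleBit, h, dite_true] at hs
      refine le_trans ?_ (single_le_sum (f := fun i : Fin n =>
        if Nat.ofBits s.1 = i then ‖φ s‖ ^ 2 else 0)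
        (fun i _ => by dsimp only; split_ifs <;> positivity)
        (mem_filter.2 ⟨mem_univ (⟨Nat.ofBits s.1, h⟩ : Fin n), hs⟩))
      simp
    · simp [oracleBit, h] at hs
  · exact sum_nonneg fun i _ => by split_ifs <;> positivity

lemma queryOp_apply {n : ℕ} (w : ℕ) (X : Input n) (φ : StateSpace n w) (s : BasisState n w) :
    queryOp w X φ s = φ (queryPerm w X s) := rfl

/-- A query on two inputs increases the squared distance of two states only through the part of
the states that addresses variables on which the inputs differ. -/
lemma norm_queryOp_sub_sq_le {n w : ℕ} (X Y : Input n) (φ ψ : StateSpace n w) :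
    ‖queryOp w X φ - queryOp w Y ψ‖ ^ 2 ≤ ‖φ - ψ‖ ^ 2 +
      2 * ((∑ i with X i ≠ Y i, addressMass φ i) + ∑ i with X i ≠ Y i, addressMass ψ i) := by
  have hφ := sum_oracleBit_ne_le X Y φ
  have hψ := sum_oracleBit_ne_le X Y ψ
  -- `R` changes only the target bit, and only where the two oracle bits differ. Substituting the
  -- query permutation of `Y` moves both queries onto `φ`.
  set R : Equiv.Perm (BasisState n w) := (queryPerm w Y).trans (queryPerm w X) with hR
  have hR1 : ∀ s, (R s).1 = s.1 := fun s => rfl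
  have hYY : ∀ s, queryPerm w Y (queryPerm w Y s) = s := fun s =>
    (queryPerm w Y).symm_apply_apply s
  have hRs : ∀ s, oracleBit X s.1 = oracleBit Y s.1 → R s = s := by
    rintro ⟨i, b, z⟩ h
    simp only at h
    change (i, ((b ^^ oracleBit Y i) ^^ oracleBit X i), z) = (i, b, z)
    rw [h, Bool.xor_assoc, Bool.xor_self, Bool.xor_false]
  have e1 : ‖queryOp w X φ - queryOp w Y ψ‖ ^ 2 = ∑ s, ‖φ (R s) - ψ s‖ ^ 2 := by
    rw [EuclideanSpace.norm_sq_eq, ← Equiv.sum_comp (queryPerm w Y)]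
    refine sum_congr rfl fun s _ => ?_
    rw [PiLp.sub_apply, queryOp_apply, queryOp_apply, hYY]
    rfl
  have e2 : (∑ s : BasisState n w, if oracleBit X s.1 ≠ oracleBit Y s.1 then ‖φ s‖ ^ 2 else 0) =
      ∑ s : BasisState n w, if oracleBit X s.1 ≠ oracleBit Y s.1 then ‖φ (R s)‖ ^ 2 else 0 := by
    rw [← Equiv.sum_comp R]
    simp only [hR1]
  rw [e2] at hφ
  have key : ∑ s, ‖φ (R s) - ψ s‖ ^ 2 ≤ ∑ s, (‖(φ - ψ) s‖ ^ 2 +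
      2 * ((if oracleBit X s.1 ≠ oracleBit Y s.1 then ‖φ (R s)‖ ^ 2 else 0) +
        (if oracleBit X s.1 ≠ oracleBit Y s.1 then ‖ψ s‖ ^ 2 else 0))) := by
    refine sum_le_sum fun s _ => ?_
    by_cases h : oracleBit X s.1 = oracleBit Y s.1
    · simp [h, hRs s h]
    · rw [if_pos h, if_pos h]
      have h1 := norm_sub_le (φ (R s)) (ψ s)
      have h2 := norm_nonneg (φ (R s) - ψ s)
      nlinarith [sq_nonneg (‖φ (R s)‖ - ‖ψ s‖), sq_nonneg ‖(φ - ψ) s‖]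
  rw [sum_add_distrib, ← mul_sum, sum_add_distrib, ← EuclideanSpace.norm_sq_eq] at key
  rw [e1]
  linarith

namespace QuantumAlgorithm

variable {n T : ℕ}

lemma norm_stateAfter (A : QuantumAlgorithm n T) (X : Input n) (t : ℕ) :
    ‖A.stateAfter X t‖ = 1 := by
  induction t with
  | zero => simp [stateAfter, A.init_norm]
  | succ t ih => simp [stateAfter, ih]

lemma norm_stateAfter_sub_sq_le (A : QuantumAlgorithm n T) (X Y : Input n) (t : ℕ) :
    ‖A.stateAfter X t - A.stateAfter Y t‖ ^ 2 ≤ ∑ u ∈ range t,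
      2 * ((∑ i with X i ≠ Y i, addressMass (A.stateAfter X u) i) +
        ∑ i with X i ≠ Y i, addressMass (A.stateAfter Y u) i) := by
  induction t with
  | zero => simp [stateAfter]
  | succ t ih =>
    rw [sum_range_succ, stateAfter, stateAfter, ← map_sub, LinearIsometryEquiv.norm_map]
    exact (norm_queryOp_sub_sq_le X Y _ _).trans (by linarith)

/-! ### Measurements -/

lemma sum_norm_meas_sq (A : QuantumAlgorithm n T) (φ : StateSpace n A.w) :
    ∑ j, ‖A.meas j φ‖ ^ 2 = ‖φ‖ ^ 2 := by
  have h := congrArg (fun L : StateSpace n A.w →L[ℂ] StateSpace n A.w => inner ℂ (L φ) φ)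
    A.meas_complete
  simp only [_root_.sum_apply, ContinuousLinearMap.comp_apply, sum_inner,
    ContinuousLinearMap.adjoint_inner_left, ContinuousLinearMap.id_apply,
    inner_self_eq_norm_sq_to_K] at h
  exact_mod_cast h

lemma sum_prob (A : QuantumAlgorithm n T) (X : Input n) : ∑ j, A.prob X j = 1 := by
  unfold prob
  rw [sum_norm_meas_sq, finalState, norm_stateAfter, one_pow]

lemma prob_nonneg (A : QuantumAlgorithm n T) (X : Input n) (j : Fin A.M) : 0 ≤ A.prob X j :=
  sq_nonneg _

/-- By completeness, measuring the difference of the states has total weight equal to its squared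
norm; the factors 2 come from `(a + b)^2 ≤ 2 * a^2 + 2 * b^2`. -/
lemma sum_prob_le (A : QuantumAlgorithm n T) (X Y : Input n) (S : Finset (Fin A.M)) :
    ∑ j ∈ S, A.prob Y j ≤
      2 * ∑ j ∈ S, A.prob X j + 2 * ‖A.finalState X - A.finalState Y‖ ^ 2 := by
  have h1 : ∑ j ∈ S, ‖A.meas j (A.finalState X - A.finalState Y)‖ ^ 2 ≤
      ‖A.finalState X - A.finalState Y‖ ^ 2 := by
    rw [← A.sum_norm_meas_sq]
    exact sum_le_univ_sum_of_nonneg fun j => sq_nonneg _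
  have h2 : ∑ j ∈ S, A.prob Y j ≤ ∑ j ∈ S, (2 * A.prob X j +
      2 * ‖A.meas j (A.finalState X - A.finalState Y)‖ ^ 2) := by
    refine sum_le_sum fun j _ => ?_
    rw [map_sub]
    unfold prob
    have h3 := norm_sub_le (A.meas j (A.finalState X))
      (A.meas j (A.finalState X) - A.meas j (A.finalState Y))
    rw [sub_sub_cancel] at h3
    nlinarith [sq_nonneg (‖A.meas j (A.finalState X)‖ -
      ‖A.meas j (A.finalState X) - A.meas j (A.finalState Y)‖),
      norm_nonneg (A.meas j (A.finalState Y))]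
  rw [sum_add_distrib, ← mul_sum, ← mul_sum] at h2
  linarith

open Classical in
lemma error_nonneg (A : QuantumAlgorithm n T) {p : ℝ} (hp : 0 < p) (X : Input n) :
    0 ≤ A.error p X := by
  refine Real.sInf_nonneg fun γ hγ => ?_
  by_contra hneg
  have : (univ.filter fun j => |mean X - A.estimate j| ≤ γ) = ∅ :=
    filter_eq_empty_iff.2 fun j _ h => hneg ((abs_nonneg _).trans h)
  simp only [Set.mem_ofPred_eq, this, sum_empty] at hγ
  linarith

open Classical in
lemma le_sum_prob_of_error_lt (A : QuantumAlgorithm n T) {p γ : ℝ} (hp : p ≤ 1) (X : Input n)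
    (h : A.error p X < γ) : p ≤ ∑ j with |mean X - A.estimate j| ≤ γ, A.prob X j := by
  -- `p ≤ 1` makes the set nonempty, so the infimum is not the default value `0`.
  have hne : {γ : ℝ | p ≤ ∑ j ∈ univ.filter (fun j => |mean X - A.estimate j| ≤ γ),
      A.prob X j}.Nonempty := by
    refine ⟨∑ j, |mean X - A.estimate j|, ?_⟩
    rw [Set.mem_ofPred_eq, filter_true_of_mem, A.sum_prob]
    · exact hp
    · intro j _
      exact single_le_sum (f := fun j => |mean X - A.estimate j|) (fun j _ => abs_nonneg _)
        (mem_univ j)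
  obtain ⟨γ', h1, h2⟩ := exists_lt_of_csInf_lt hne h
  refine le_trans h1 (sum_le_sum_of_subset_of_nonneg ?_ fun j _ _ => A.prob_nonneg X j)
  exact monotone_filter_right _ fun j _ hj => le_trans hj h2.le

end QuantumAlgorithm

/-! ### Averages over permutations of the variables -/

lemma weight_comp_perm {n : ℕ} (X : Input n) (σ : Equiv.Perm (Fin n)) :
    weight (X ∘ σ) = weight X := by
  unfold weight
  exact card_equiv σ (by simp)

lemma exists_perm_of_weight_eq {n : ℕ} {X Y : Input n} (h : weight X = weight Y) :
    ∃ τ : Equiv.Perm (Fin n), X = Y ∘ τ := by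
  have hc : Fintype.card {i // X i = true} = Fintype.card {i // Y i = true} := by
    rw [Fintype.card_subtype, Fintype.card_subtype]
    exact h
  let e := Fintype.equivOfCardEq hc
  refine ⟨e.extendSubtype, funext fun i => ?_⟩
  by_cases hi : X i = true
  · have := e.extendSubtype_mem i hi
    simp [hi, this]
  · have := e.extendSubtype_not_mem i hi
    simp only [Bool.not_eq_true] at hi this
    simp [hi, this]

lemma card_weight_eq (n l : ℕ) : #{X : Input n | weight X = l} = n.choose l := by
  rw [← card_fin n, ← card_powersetCard l (univ : Finset (Fin n)), card_fin]
  refine card_nbij' (fun X => univ.filter fun i => X i = true) (fun s i => decide (i ∈ s)) ?_ ?_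
    ?_ ?_
  · intro X hX
    exact mem_powersetCard.2 ⟨subset_univ _, (mem_filter.1 (mem_coe.1 hX)).2⟩
  · intro s hs
    exact mem_filter.2 ⟨mem_univ _, by simpa [weight] using (mem_powersetCard.1 (mem_coe.1 hs)).2⟩
  · intro X _
    ext i
    simp
  · intro s _
    ext i
    simp

lemma weight_le {n : ℕ} (X : Input n) : weight X ≤ n :=
  (card_le_univ _).trans_eq (Fintype.card_fin n)

/-- Permuting the variables at random turns any input into a uniformly distributed input of the
same weight. -/
lemma choose_mul_sum_perm {n : ℕ} (f : Input n → ℝ) (X : Input n) :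
    (n.choose (weight X) : ℝ) * ∑ σ : Equiv.Perm (Fin n), f (X ∘ σ) =
      n.factorial * ∑ Y with weight Y = weight X, f Y := by
  have h1 : ∀ Y : Input n, weight Y = weight X →
      ∑ σ : Equiv.Perm (Fin n), f (Y ∘ σ) = ∑ σ : Equiv.Perm (Fin n), f (X ∘ σ) := by
    intro Y hY
    obtain ⟨τ, rfl⟩ := exists_perm_of_weight_eq hY
    exact Equiv.sum_comp (Equiv.mulLeft τ) fun σ : Equiv.Perm (Fin n) => f (X ∘ σ)
  have h2 : ∀ σ : Equiv.Perm (Fin n),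
      ∑ Y with weight Y = weight X, f (Y ∘ σ) = ∑ Y with weight Y = weight X, f Y := by
    intro σ
    refine sum_equiv (Equiv.arrowCongr σ.symm (Equiv.refl Bool)) ?_ ?_
    · intro Y
      simp only [mem_filter, mem_univ, true_and]
      change weight Y = weight X ↔ weight (Y ∘ σ) = weight X
      rw [weight_comp_perm]
    · intro Y _
      rfl
  calc (n.choose (weight X) : ℝ) * ∑ σ : Equiv.Perm (Fin n), f (X ∘ σ)
      = ∑ Y with weight Y = weight X, ∑ σ : Equiv.Perm (Fin n), f (Y ∘ σ) := by
        rw [sum_congr rfl fun Y hY => h1 Y (mem_filter.1 hY).2, sum_const, card_weight_eq,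
          nsmul_eq_mul]
    _ = n.factorial * ∑ Y with weight Y = weight X, f Y := by
        rw [sum_comm, sum_congr rfl fun σ _ => h2 σ, sum_const, card_univ, Fintype.card_perm,
          Fintype.card_fin, nsmul_eq_mul]

/-- If `a X` is a subprobability vector on the variables, then after a random permutation of the
variables a set `S` of variables on which `X` is constant receives at most its proportional share
of the mass. -/
lemma card_mul_sum_perm_le {n : ℕ} (a : Input n → Fin n → ℝ) (ha : ∀ X i, 0 ≤ a X i)
    (ha1 : ∀ X, ∑ i, a X i ≤ 1) (X : Input n) (b : Bool) (S : Finset (Fin n))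
    (hS : ∀ l ∈ S, X l = b) :
    (#{l | X l = b} : ℝ) * ∑ σ : Equiv.Perm (Fin n), ∑ i with σ i ∈ S, a (X ∘ σ) i ≤
      #S * n.factorial := by
  have hre : ∀ σ : Equiv.Perm (Fin n),
      ∑ i with σ i ∈ S, a (X ∘ σ) i = ∑ l ∈ S, a (X ∘ σ) (σ.symm l) := by
    intro σ
    exact sum_equiv σ (by simp) (by simp)
  have hsw : ∀ l l', X l = b → X l' = b →
      ∑ σ : Equiv.Perm (Fin n), a (X ∘ σ) (σ.symm l) =
        ∑ σ : Equiv.Perm (Fin n), a (X ∘ σ) (σ.symm l') := by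
    intro l l' hl hl'
    -- Swapping two variables with equal values fixes `X`, so all variables of value `b` receive the
    -- same average mass.
    rw [← Equiv.sum_comp (Equiv.mulLeft (Equiv.swap l l'))]
    refine sum_congr rfl fun σ _ => ?_
    have h1 : X ∘ (Equiv.swap l l' * σ : Equiv.Perm (Fin n)) = X ∘ σ := by
      funext i
      simp only [Function.comp_apply, Equiv.Perm.mul_apply]
      rcases Equiv.swap_apply_def l l' (σ i) with h
      rw [h]
      split_ifs with h1 h2
      · rw [h1, hl, hl']
      · rw [h2, hl, hl']
      · rfl
    have h2 : (Equiv.swap l l' * σ : Equiv.Perm (Fin n)).symm l = σ.symm l' := by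
      rw [Equiv.symm_apply_eq]
      simp
    simp only [Equiv.coe_mulLeft]
    rw [h1, h2]
  have hone : ∀ l, X l = b →
      (#{l | X l = b} : ℝ) * ∑ σ : Equiv.Perm (Fin n), a (X ∘ σ) (σ.symm l) ≤ n.factorial := by
    intro l hl
    calc (#{l | X l = b} : ℝ) * ∑ σ : Equiv.Perm (Fin n), a (X ∘ σ) (σ.symm l)
        = ∑ l' with X l' = b, ∑ σ : Equiv.Perm (Fin n), a (X ∘ σ) (σ.symm l') := by
          rw [sum_congr rfl fun l' hl' => hsw l' l (mem_filter.1 hl').2 hl, sum_const,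
            nsmul_eq_mul]
      _ = ∑ σ : Equiv.Perm (Fin n), ∑ l' with X l' = b, a (X ∘ σ) (σ.symm l') := sum_comm
      _ ≤ ∑ σ : Equiv.Perm (Fin n), (1 : ℝ) := by
          refine sum_le_sum fun σ _ => ?_
          refine le_trans (sum_le_univ_sum_of_nonneg fun l' => ha _ _) ?_
          rw [Equiv.sum_comp σ.symm (fun i => a (X ∘ σ) i)]
          exact ha1 _
      _ = n.factorial := by simp [Fintype.card_perm]
  calc (#{l | X l = b} : ℝ) * ∑ σ : Equiv.Perm (Fin n), ∑ i with σ i ∈ S, a (X ∘ σ) i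
      = ∑ l ∈ S, (#{l | X l = b} : ℝ) * ∑ σ : Equiv.Perm (Fin n), a (X ∘ σ) (σ.symm l) := by
        rw [sum_congr rfl fun σ _ => hre σ, sum_comm, mul_sum]
    _ ≤ ∑ l ∈ S, (n.factorial : ℝ) := sum_le_sum fun l hl => hone l (hS l hl)
    _ = #S * n.factorial := by rw [sum_const, nsmul_eq_mul]

/-! ### Reference inputs of prescribed weight -/

/-- The input whose first `k` variables are `1`. -/
def initialOnes (n k : ℕ) : Input n := fun i => decide (i.val < k)

lemma card_val_lt {n k : ℕ} (hk : k ≤ n) : #{i : Fin n | i.val < k} = k := by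
  rw [Fin.card_filter_val_lt, min_eq_right hk]

lemma weight_initialOnes {n k : ℕ} (hk : k ≤ n) : weight (initialOnes n k) = k := by
  simpa [weight, initialOnes] using card_val_lt hk

lemma card_initialOnes_eq_false {n k : ℕ} (hk : k ≤ n) :
    #{i | initialOnes n k i = false} = n - k := by
  have h := card_filter_add_card_filter_not (s := (univ : Finset (Fin n)))
    fun i => initialOnes n k i = true
  have h2 : #{i | initialOnes n k i = true} = k := weight_initialOnes hk
  simp only [Bool.not_eq_true, card_fin] at h
  omega

lemma card_initialOnes_ne {n k d : ℕ} (h : k + d ≤ n) :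
    #{i | initialOnes n k i ≠ initialOnes n (k + d) i} = d := by
  have h1 : #{i : Fin n | i.val < k + d} =
      #{i : Fin n | i.val < k} + #{i | initialOnes n k i ≠ initialOnes n (k + d) i} := by
    rw [← card_union_of_disjoint]
    · congr 1
      ext i
      simp only [initialOnes, ne_eq, decide_eq_decide, mem_filter, mem_univ, true_and, mem_union]
      omega
    · rw [disjoint_left]
      intro i
      simp only [initialOnes, ne_eq, decide_eq_decide, mem_filter, mem_univ, true_and]
      omega
  rw [card_val_lt h, card_val_lt (by omega)] at h1
  omega

/-! ### Lower bounds for the average error -/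

namespace QuantumAlgorithm

variable {n T : ℕ}

/-- On average over permutations of the variables, the final states for inputs of weights `k` and
`k + d` are close. -/
lemma sum_perm_norm_finalState_sub_sq_le (A : QuantumAlgorithm n T) {k d : ℕ} (hkd : k + d ≤ n)
    (hk : n ≤ 4 * k) (hk' : n ≤ 4 * (n - k)) (hn : 0 < n) :
    ∑ σ : Equiv.Perm (Fin n),
      ‖A.finalState (initialOnes n k ∘ σ) - A.finalState (initialOnes n (k + d) ∘ σ)‖ ^ 2 ≤
      16 * T * d / n * n.factorial := by
  set S : Finset (Fin n) := {i | initialOnes n k i ≠ initialOnes n (k + d) i} with hS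
  have hSc : #S = d := card_initialOnes_ne hkd
  have hn' : (0 : ℝ) < n := by exact_mod_cast hn
  have hmass : ∀ (u : ℕ) (l : ℕ) (b : Bool), (∀ i ∈ S, initialOnes n l i = b) →
      n ≤ 4 * #{i | initialOnes n l i = b} →
      ∑ σ : Equiv.Perm (Fin n), ∑ i with σ i ∈ S,
        addressMass (A.stateAfter (initialOnes n l ∘ σ) u) i ≤ 4 * d / n * n.factorial := by
    intro u l b hb hc
    have h := card_mul_sum_perm_le (fun X i => addressMass (A.stateAfter X u) i)
      (fun X i => addressMass_nonneg _ i)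
      (fun X => (sum_addressMass_le _).trans_eq (by rw [norm_stateAfter, one_pow]))
      (initialOnes n l) b S hb
    rw [hSc] at h
    have h0 : 0 ≤ ∑ σ : Equiv.Perm (Fin n), ∑ i with σ i ∈ S,
        addressMass (A.stateAfter (initialOnes n l ∘ σ) u) i :=
      sum_nonneg fun σ _ => sum_nonneg fun i _ => addressMass_nonneg _ i
    have hc' : (n : ℝ) ≤ 4 * (#{i | initialOnes n l i = b} : ℝ) := by exact_mod_cast hc
    rw [div_mul_eq_mul_div, le_div_iff₀ hn']
    have := mul_le_mul_of_nonneg_right hc' h0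
    linarith
  have hmem : ∀ i ∈ S, k ≤ i.val ∧ i.val < k + d := by
    intro i hi
    simp only [hS, initialOnes, ne_eq, decide_eq_decide, mem_filter, mem_univ, true_and] at hi
    omega
  calc ∑ σ : Equiv.Perm (Fin n),
        ‖A.finalState (initialOnes n k ∘ σ) - A.finalState (initialOnes n (k + d) ∘ σ)‖ ^ 2
      ≤ ∑ σ : Equiv.Perm (Fin n), ∑ u ∈ range T,
        2 * ((∑ i with σ i ∈ S, addressMass (A.stateAfter (initialOnes n k ∘ σ) u) i) +
          ∑ i with σ i ∈ S, addressMass (A.stateAfter (initialOnes n (k + d) ∘ σ) u) i) := by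
        refine sum_le_sum fun σ _ => ?_
        refine (A.norm_stateAfter_sub_sq_le _ _ T).trans_eq ?_
        simp [hS]
    _ = ∑ u ∈ range T, 2 * ((∑ σ : Equiv.Perm (Fin n), ∑ i with σ i ∈ S,
            addressMass (A.stateAfter (initialOnes n k ∘ σ) u) i) +
          ∑ σ : Equiv.Perm (Fin n), ∑ i with σ i ∈ S,
            addressMass (A.stateAfter (initialOnes n (k + d) ∘ σ) u) i) := by
        rw [sum_comm]
        simp only [← mul_sum, ← sum_add_distrib]
    _ ≤ ∑ u ∈ range T, (2 : ℝ) * (4 * d / n * n.factorial + 4 * d / n * n.factorial) := by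
        refine sum_le_sum fun u _ => ?_
        have h1 := hmass u k false (fun i hi => by simpa [initialOnes] using (hmem i hi).1)
          (by rw [card_initialOnes_eq_false (by omega)]; exact hk')
        have h2 := hmass u (k + d) true (fun i hi => by simpa [initialOnes] using (hmem i hi).2)
          (by
            have : #{i | initialOnes n (k + d) i = true} = k + d := weight_initialOnes hkd
            omega)
        linarith
    _ = 16 * T * d / n * n.factorial := by
        rw [sum_const, card_range, nsmul_eq_mul]
        ring

/-- The average of the error over the inputs of weight `l`. -/
noncomputable def levelError (A : QuantumAlgorithm n T) (p : ℝ) (l : ℕ) : ℝ :=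
  (∑ σ : Equiv.Perm (Fin n), A.error p (initialOnes n l ∘ σ)) / n.factorial

lemma levelError_nonneg (A : QuantumAlgorithm n T) {p : ℝ} (hp : 0 < p) (l : ℕ) :
    0 ≤ A.levelError p l :=
  div_nonneg (sum_nonneg fun _ _ => A.error_nonneg hp _) (by positivity)

/-- `mu₂` gives each weight total mass `1 / (n + 1)`, spread uniformly within the level. -/
lemma avgError_mu₂ (A : QuantumAlgorithm n T) (p : ℝ) :
    A.avgError mu₂ p = (∑ l ∈ range (n + 1), A.levelError p l) / (n + 1) := by
  unfold avgError
  rw [← sum_fiberwise_of_maps_to (s := univ) (t := range (n + 1)) (g := weight)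
    fun X _ => mem_range.2 (Nat.lt_succ_of_le (weight_le X)), sum_div]
  refine sum_congr rfl fun l hl => ?_
  have hl' : l ≤ n := Nat.lt_succ_iff.1 (mem_range.1 hl)
  have h := choose_mul_sum_perm (A.error p) (initialOnes n l)
  rw [weight_initialOnes hl'] at h
  have h1 : ∑ X with weight X = l, A.error p X * mu₂ X =
      (∑ X with weight X = l, A.error p X) * (1 / (((n : ℝ) + 1) * (n.choose l : ℝ))) := by
    rw [sum_mul]
    refine sum_congr rfl fun X hX => ?_
    rw [mu₂, (mem_filter.1 hX).2]
  have hc : (n.choose l : ℝ) ≠ 0 := by exact_mod_cast (Nat.choose_pos hl').ne'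
  have hf : (n.factorial : ℝ) ≠ 0 := by exact_mod_cast n.factorial_ne_zero
  have hn : (n : ℝ) + 1 ≠ 0 := by positivity
  rw [h1, levelError]
  field_simp
  linarith

open Classical in
/-- Outcomes that are correct for one of eight well separated weights are disjoint events, so they
cannot all be likely on inputs whose final states are close to each other. -/
lemma one_le_sum_error (A : QuantumAlgorithm n T) {p : ℝ} (hp : 1 / 2 < p) (hp1 : p ≤ 1)
    {d : ℕ} (hd : 0 < d) (hn : 0 < n) (X : ℕ → Input n) (k : ℕ)
    (hX : ∀ j ≤ 8, weight (X j) = k + j * d) :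
    2 - 2 * ∑ j ∈ Icc 1 8, ‖A.finalState (X 0) - A.finalState (X j)‖ ^ 2 ≤
      (∑ j ∈ Icc 1 8, A.error p (X j)) * (3 * n / (2 * d)) := by
  have hn' : (0 : ℝ) < n := by exact_mod_cast hn
  have hd' : (0 : ℝ) < d := by exact_mod_cast hd
  -- Since `2 * γ < d / n`, the spacing of the means, the sets `S j` are disjoint.
  set γ : ℝ := d / (3 * n) with hγ
  have hγ0 : 0 < γ := by positivity
  let S : ℕ → Finset (Fin A.M) := fun j => univ.filter fun o => |mean (X j) - A.estimate o| ≤ γ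
  have hdisj : ∀ i j, i ≤ 8 → j ≤ 8 → i < j → Disjoint (S i) (S j) := by
    intro i j hi hj hij
    rw [disjoint_left]
    intro o h1 h2
    have h1 := (abs_le.1 (mem_filter.1 h1).2).1
    have h2 := (abs_le.1 (mem_filter.1 h2).2).2
    rw [mean, hX i hi] at h1
    rw [mean, hX j hj] at h2
    have h3 : ((k + j * d : ℕ) : ℝ) / n - ((k + i * d : ℕ) : ℝ) / n ≤ 2 * γ := by linarith
    rw [← sub_div, hγ, div_le_iff₀ hn'] at h3
    have h4 : 2 * ((d : ℝ) / (3 * n)) * n = 2 / 3 * d := by field_simp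
    rw [h4] at h3
    have h5 : (i : ℝ) + 1 ≤ j := by exact_mod_cast hij
    push_cast at h3
    nlinarith
  have hpd : (↑(Icc 1 8) : Set ℕ).PairwiseDisjoint S := by
    intro i hi j hj hij
    have hi := (mem_Icc.1 (mem_coe.1 hi)).2
    have hj := (mem_Icc.1 (mem_coe.1 hj)).2
    rcases lt_or_gt_of_ne hij with h | h
    · exact hdisj i j hi hj h
    · exact (hdisj j i hj hi h).symm
  have hsum : ∑ j ∈ Icc 1 8, ∑ o ∈ S j, A.prob (X 0) o ≤ 1 := by
    rw [← sum_biUnion hpd, ← A.sum_prob (X 0)]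
    exact sum_le_univ_sum_of_nonneg fun o => A.prob_nonneg _ o
  -- An error of at least `γ` makes the left side nonpositive; a smaller one gives probability at
  -- least `p > 1/2`.
  have hlow : ∀ j, 1 / 2 - A.error p (X j) * (3 * n / (2 * d)) ≤ ∑ o ∈ S j, A.prob (X j) o := by
    intro j
    have e1 : γ * (3 * n / (2 * d)) = 1 / 2 := by rw [hγ]; field_simp
    rcases lt_or_ge (A.error p (X j)) γ with h | h
    · have h1 := A.le_sum_prob_of_error_lt hp1 (X j) h
      have h2 : 0 ≤ A.error p (X j) * (3 * n / (2 * d)) :=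
        mul_nonneg (A.error_nonneg (by linarith) _) (by positivity)
      have h3 : p ≤ ∑ o ∈ S j, A.prob (X j) o := h1
      linarith
    · have h1 := mul_le_mul_of_nonneg_right h (show (0 : ℝ) ≤ 3 * n / (2 * d) by positivity)
      have h2 : 0 ≤ ∑ o ∈ S j, A.prob (X j) o := sum_nonneg fun o _ => A.prob_nonneg _ o
      linarith
  have hall : ∑ j ∈ Icc 1 8, (1 / 2 - A.error p (X j) * (3 * n / (2 * d))) ≤
      ∑ j ∈ Icc 1 8, (2 * ∑ o ∈ S j, A.prob (X 0) o +
        2 * ‖A.finalState (X 0) - A.finalState (X j)‖ ^ 2) :=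
    sum_le_sum fun j _ => (hlow j).trans (A.sum_prob_le (X 0) (X j) (S j))
  -- Eight halves give 4 on the left; disjointness bounds the probabilities on the right by 2.
  rw [sum_sub_distrib, sum_add_distrib, ← mul_sum, ← mul_sum, ← sum_mul, sum_const,
    Nat.card_Icc] at hall
  norm_num at hall
  linarith

/-- The average over permutations of the eight squared distances sums to at most `16 * (1 + ⋯ + 8) *
T * d / n = 576 * T * d / n`, which `hT` makes at most `1/2`. -/
lemma le_sum_levelError (A : QuantumAlgorithm n T) {p : ℝ} (hp : 1 / 2 < p) (hp1 : p ≤ 1)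
    {k d : ℕ} (hd : 0 < d) (hkd : k + 8 * d ≤ n) (hk : n ≤ 4 * k) (hk' : n ≤ 4 * (n - k))
    (hT : 1152 * T * d ≤ n) :
    2 * (d : ℝ) / (3 * n) ≤ ∑ j ∈ Icc 1 8, A.levelError p (k + j * d) := by
  have hn : 0 < n := by omega
  have hn' : (0 : ℝ) < n := by exact_mod_cast hn
  have hd' : (0 : ℝ) < d := by exact_mod_cast hd
  have hf : (0 : ℝ) < n.factorial := by exact_mod_cast n.factorial_pos
  have hT' : 1152 * (T : ℝ) * d ≤ n := by exact_mod_cast hT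
  have h1 : ∑ σ : Equiv.Perm (Fin n), (2 - 2 * ∑ j ∈ Icc 1 8,
        ‖A.finalState (initialOnes n k ∘ σ) -
          A.finalState (initialOnes n (k + j * d) ∘ σ)‖ ^ 2) ≤
      ∑ σ : Equiv.Perm (Fin n),
        (∑ j ∈ Icc 1 8, A.error p (initialOnes n (k + j * d) ∘ σ)) * (3 * n / (2 * d)) := by
    refine sum_le_sum fun σ _ => ?_
    have := A.one_le_sum_error hp hp1 hd hn (fun j => initialOnes n (k + j * d) ∘ σ) k
      fun j hj => by
        rw [weight_comp_perm, weight_initialOnes]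
        have := Nat.mul_le_mul_right d hj
        omega
    simpa using this
  have h2 : ∑ σ : Equiv.Perm (Fin n), ∑ j ∈ Icc 1 8,
        ‖A.finalState (initialOnes n k ∘ σ) -
          A.finalState (initialOnes n (k + j * d) ∘ σ)‖ ^ 2 ≤ 1 / 2 * n.factorial := by
    rw [sum_comm]
    calc ∑ j ∈ Icc 1 8, ∑ σ : Equiv.Perm (Fin n), ‖A.finalState (initialOnes n k ∘ σ) -
          A.finalState (initialOnes n (k + j * d) ∘ σ)‖ ^ 2
        ≤ ∑ j ∈ Icc 1 8, 16 * T * ((j * d : ℕ) : ℝ) / n * n.factorial := by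
          refine sum_le_sum fun j hj => ?_
          have := Nat.mul_le_mul_right d (mem_Icc.1 hj).2
          exact A.sum_perm_norm_finalState_sub_sq_le (by omega) hk hk' hn
      _ = 576 * T * d / n * n.factorial := by
          simp only [sum_Icc_succ_top, Nat.reduceLeDiff, Icc_self, sum_singleton]
          norm_num
          ring
      _ ≤ 1 / 2 * n.factorial := by
          refine mul_le_mul_of_nonneg_right ?_ hf.le
          rw [div_le_iff₀ hn']
          linarith
  have h3 : ∑ j ∈ Icc 1 8, A.levelError p (k + j * d) =
      (∑ σ : Equiv.Perm (Fin n), ∑ j ∈ Icc 1 8, A.error p (initialOnes n (k + j * d) ∘ σ)) /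
        n.factorial := by
    rw [sum_comm, sum_div]
    rfl
  rw [sum_sub_distrib, sum_const, card_univ, Fintype.card_perm, Fintype.card_fin, nsmul_eq_mul,
    ← mul_sum, ← sum_mul] at h1
  rw [h3, le_div_iff₀ hf]
  have h4 : (n.factorial : ℝ) ≤ (∑ σ : Equiv.Perm (Fin n), ∑ j ∈ Icc 1 8,
      A.error p (initialOnes n (k + j * d) ∘ σ)) * (3 * n / (2 * d)) := by linarith
  rw [mul_div_assoc', le_div_iff₀ (by positivity)] at h4
  rw [div_mul_eq_mul_div, div_le_iff₀ (by positivity)]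
  linarith

lemma le_avgCountError (A : QuantumAlgorithm n T) {p : ℝ} (hp : 1 / 2 < p) (hp1 : p ≤ 1)
    {d : ℕ} (hd : 0 < d) (hdn : 1152 * d ≤ n) (hT : 1152 * T * d ≤ n) :
    (d : ℝ) / 192 ≤ A.avgCountError mu₂ p := by
  have hn' : (0 : ℝ) < n := by exact_mod_cast (by omega : 0 < n)
  have hp0 : 0 < p := by linarith
  have h1 : ∑ k ∈ Ico (n / 2) (3 * n / 4), 2 * (d : ℝ) / (3 * n) ≤
      ∑ k ∈ Ico (n / 2) (3 * n / 4), ∑ j ∈ Icc 1 8, A.levelError p (k + j * d) := by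
    refine sum_le_sum fun k hk => ?_
    rw [mem_Ico] at hk
    exact A.le_sum_levelError hp hp1 hd (by omega) (by omega) (by omega) hT
  have h2 : ∑ k ∈ Ico (n / 2) (3 * n / 4), ∑ j ∈ Icc 1 8, A.levelError p (k + j * d) ≤
      ∑ j ∈ Icc 1 8, ∑ l ∈ range (n + 1), A.levelError p l := by
    rw [sum_comm]
    refine sum_le_sum fun j hj => ?_
    have hj := Nat.mul_le_mul_right d (mem_Icc.1 hj).2
    refine (sum_map (Ico (n / 2) (3 * n / 4)) (addRightEmbedding (j * d))
      fun l => A.levelError p l).symm.trans_le ?_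
    refine sum_le_sum_of_subset_of_nonneg ?_ fun l _ _ => A.levelError_nonneg hp0 l
    rw [map_add_right_Ico]
    intro l hl
    rw [mem_Ico] at hl
    rw [mem_range]
    omega
  rw [sum_const, Nat.card_Ico, nsmul_eq_mul] at h1
  rw [sum_const, Nat.card_Icc, nsmul_eq_mul] at h2
  have h3 : (n : ℝ) / 8 ≤ ((3 * n / 4 - n / 2 : ℕ) : ℝ) := by
    rw [div_le_iff₀ (by norm_num)]
    exact_mod_cast (by omega : n ≤ (3 * n / 4 - n / 2) * 8)
  have h4 : (d : ℝ) / 12 ≤ ((3 * n / 4 - n / 2 : ℕ) : ℝ) * (2 * (d : ℝ) / (3 * n)) := by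
    refine le_trans (le_of_eq ?_) (mul_le_mul_of_nonneg_right h3 (by positivity))
    field_simp
    norm_num
  have h5 : (d : ℝ) / 96 ≤ ∑ l ∈ range (n + 1), A.levelError p l := by
    norm_num at h2
    linarith
  rw [avgCountError, avgError_mu₂, mul_div_assoc', le_div_iff₀ (by positivity)]
  have hn1 : (1 : ℝ) ≤ n := by exact_mod_cast (by omega : 1 ≤ n)
  have hd' : (0 : ℝ) < d := by exact_mod_cast hd
  nlinarith

/-- The lower bound for the average error, for all numbers `n` of variables and `T` of queries. -/
lemma div_max_le_avgCountError (A : QuantumAlgorithm n T) {p : ℝ} (hp : 1 / 2 < p) (hp1 : p ≤ 1)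
    (hT : 1152 * max T 1 ≤ n) :
    1 / 442368 * ((n : ℝ) / max (T : ℝ) 1) ≤ A.avgCountError mu₂ p := by
  set M := max T 1 with hM
  have hM1 : 1 ≤ M := le_max_right _ _
  have hcast : max (T : ℝ) 1 = M := by rw [hM]; push_cast; rfl
  -- The largest spacing allowed. Rounding down loses at most a factor 2, whence `442368 = 192 *
  -- 2304`.
  set d := n / (1152 * M) with hd
  have hd0 : 0 < d := Nat.div_pos hT (by omega)
  have hdM : 1152 * M * d ≤ n := Nat.mul_div_le n _
  have hlt : n < 1152 * M * (d + 1) := Nat.lt_mul_div_succ n (by omega)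
  have h := A.le_avgCountError hp hp1 hd0
    (le_trans (Nat.mul_le_mul_right d (by omega)) hdM)
    (le_trans (Nat.mul_le_mul_right d (Nat.mul_le_mul_left _ (le_max_left _ _))) hdM)
  refine le_trans ?_ h
  have hM0 : (0 : ℝ) < M := by exact_mod_cast hM1
  have h1 : (n : ℝ) ≤ 1152 * M * (d + 1) := by exact_mod_cast hlt.le
  have h2 : (1 : ℝ) ≤ d := by exact_mod_cast hd0
  have h3 : (n : ℝ) / M ≤ 2304 * d := by
    rw [div_le_iff₀ hM0]
    nlinarith
  rw [hcast]
  linarith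

end QuantumAlgorithm

end QuantumCounting

/-! ### The two asymptotic statements -/

theorem corollary3p3 :
    (∃ c : ℝ, 0 < c ∧ ∀ p : ℝ, 1 / 2 < p → p ≤ 1 →
      ∀ T : ℕ → ℕ, (fun n : ℕ => (T n : ℝ)) =o[atTop] (fun n : ℕ => (n : ℝ)) →
      ∀ᶠ n : ℕ in atTop, ∀ A : QuantumCounting.QuantumAlgorithm n (T n),
        c * ((n : ℝ) / max (T n : ℝ) 1) ≤ A.avgCountError QuantumCounting.mu₂ p) ∧
    (∃ c : ℝ, 0 < c ∧ ∀ p : ℝ, 1 / 2 < p → p ≤ 1 →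
      ∀ Δ : ℕ → ℝ, (∀ n : ℕ, 0 < Δ n) → Δ =o[atTop] (fun n : ℕ => (n : ℝ)) →
      ∀ᶠ n : ℕ in atTop, ∀ (T : ℕ) (A : QuantumCounting.QuantumAlgorithm n T),
        A.avgCountError QuantumCounting.mu₂ p ≤ Δ n →
          c * min ((n : ℝ) / Δ n) (n : ℝ) ≤ (T : ℝ)) := by
  refine ⟨⟨1 / 442368, by norm_num, ?_⟩, ⟨1 / 442368, by norm_num, ?_⟩⟩
  · intro p hp hp1 T hT
    filter_upwards [hT.bound (show (0 : ℝ) < 1 / 1152 by norm_num), eventually_ge_atTop 1152]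
      with n hn hn' A
    refine A.div_max_le_avgCountError hp hp1 ?_
    simp only [Real.norm_natCast] at hn
    have : 1152 * T n ≤ n := by
      have h : 1152 * (T n : ℝ) ≤ n := by linarith
      exact_mod_cast h
    omega
  · intro p hp hp1 Δ hΔ hΔo
    -- A constant just below `1 / 442368` rules out `T = 0`, where the error would be at least `n /
    -- 442368`.
    filter_upwards [hΔo.bound (show (0 : ℝ) < 1 / 442369 by norm_num), eventually_ge_atTop 1152]
      with n hn hn' T A hA
    have hn0 : (0 : ℝ) < n := by exact_mod_cast (by omega : 0 < n)
    rw [Real.norm_of_nonneg (hΔ n).le, Real.norm_natCast] at hn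
    by_cases hT : 1152 * max T 1 ≤ n
    · have h := (A.div_max_le_avgCountError hp hp1 hT).trans hA
      rcases Nat.eq_zero_or_pos T with h0 | h0
      · subst h0
        norm_num at h
        linarith
      · have hT1 : (1 : ℝ) ≤ T := by exact_mod_cast h0
        rw [max_eq_left hT1] at h
        refine le_trans (mul_le_mul_of_nonneg_left (min_le_left _ _) (by norm_num)) ?_
        rw [mul_div_assoc', div_le_iff₀ (by linarith)] at h
        rw [mul_div_assoc', div_le_iff₀ (hΔ n)]
        linarith
    · have hT' : n < 1152 * T := by omega
      have hT'' : (n : ℝ) ≤ 1152 * T := by exact_mod_cast hT'.le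
      have := min_le_right ((n : ℝ) / Δ n) (n : ℝ)
      linarith
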